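/- Let $\Gamma$ be a countable (discrete) group and let $X$ be a compact metrizable abelian group, equipped with a metric $d$ that induces its topology. Let $\Gamma$ act on $X$ by continuous group automorphisms, $(g,x)\mapsto g\cdot x$. Assume that (i) the action is expansive: there is $\eta>0$ such that for all $x,y\in X$, if $d(g\cdot x,g\cdot y)<\eta$ for every $g\in\Gamma$, then $x=y$; (ii) the action has the pseudo-orbit tracing property: for every $\varepsilon>0$ there are $\delta>0$ and a finite set $S\subset\Gamma$ such that for every family $(x_g)_{g\in\Gamma}$ in $X$ with $d(s\cdot x_g,x_{sg})<\delta$ for all $s\in S$ and $g\in\Gamma$, there is a point $x\in X$ with $d(g\cdot x,x_g)<\varepsilon$ for all $g\in\Gamma$. Then the Pontryagin dual $\widehat X$ (the group of continuous homomorphisms from $X$ to the circle group), with the left module structure over the integral group ring $\mathbb{Z}\Gamma$ determined by $(g\cdot\chi)(x)=\chi(g^{-1}\cdot x)$, is finitely presented: it is isomorphic to $(\mathbb{Z}\Gamma)^k/J$ for some $k\in\mathbb{N}$ and some finitely generated left $\mathbb{Z}\Gamma$-submodule $J\subset(\mathbb{Z}\Gamma)^k$. -/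

import Mathlib

/-! Actions of a group `Γ` on a metric space `X`: expansiveness and the pseudo-orbit tracing
property. -/

section Dynamics

/-- The action of `Γ` on the metric space `X` is expansive: there is an expansive constant `η > 0`
such that two points whose orbits stay at distance less than `η` are equal. -/
def IsExpansiveAction (Γ X : Type*) [Group Γ] [MetricSpace X] [MulAction Γ X] : Prop :=
  ∃ η : ℝ, 0 < η ∧ ∀ x y : X, (∀ g : Γ, dist (g • x) (g • y) < η) → x = y

/-- The `Γ`-sequence `x` is an `(S, δ)` pseudo-orbit: `d (s • x_g, x_{sg}) < δ` for all `s ∈ S` and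
all `g ∈ Γ`. -/
def IsPseudoOrbit {Γ X : Type*} [Group Γ] [MetricSpace X] [MulAction Γ X]
    (S : Set Γ) (δ : ℝ) (x : Γ → X) : Prop :=
  ∀ s ∈ S, ∀ g : Γ, dist (s • x g) (x (s * g)) < δ

/-- The `Γ`-sequence `x` is `ε`-traced by the point `y`. -/
def IsTracedBy {Γ X : Type*} [Group Γ] [MetricSpace X] [MulAction Γ X]
    (ε : ℝ) (x : Γ → X) (y : X) : Prop :=
  ∀ g : Γ, dist (g • y) (x g) < ε

/-- The pseudo-orbit tracing property of the action of `Γ` on `X`. -/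
def HasPseudoOrbitTracing (Γ X : Type*) [Group Γ] [MetricSpace X] [MulAction Γ X] : Prop :=
  ∀ ε : ℝ, 0 < ε → ∃ δ : ℝ, 0 < δ ∧ ∃ S : Set Γ, S.Finite ∧
    ∀ x : Γ → X, IsPseudoOrbit S δ x → ∃ y : X, IsTracedBy ε x y

end Dynamics

noncomputable section DualModule

variable (Γ X : Type*) [Group Γ] [TopologicalSpace X] [CommGroup X]
  [MulDistribMulAction Γ X] [ContinuousConstSMul Γ X]

/-- The continuous endomorphism `x ↦ g • x` of `X`. -/
def actionHom (g : Γ) : X →ₜ* X where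
  toMonoidHom := MulDistribMulAction.toMonoidHom X g
  continuous_toFun := continuous_const_smul g

/-- The action of `Γ` on the Pontryagin dual of `X` (written additively), as a representation over
`ℤ`: `(g • χ) x = χ (g⁻¹ • x)`. -/
def dualRepresentation : Representation ℤ Γ (Additive (PontryaginDual X)) where
  toFun g :=
    (MonoidHom.toAdditive (PontryaginDual.map (actionHom Γ X g⁻¹)).toMonoidHom).toIntLinearMap
  map_one' := by
    refine LinearMap.ext fun χ => Additive.toMul.injective (PontryaginDual.ext fun x => ?_)
    change χ.toMul ((1 : Γ)⁻¹ • x) = χ.toMul x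
    rw [inv_one, one_smul]
  map_mul' g h := by
    refine LinearMap.ext fun χ => Additive.toMul.injective (PontryaginDual.ext fun x => ?_)
    change χ.toMul ((g * h)⁻¹ • x) = χ.toMul (h⁻¹ • g⁻¹ • x)
    rw [mul_inv_rev, mul_smul]

theorem dualRepresentation_apply (g : Γ) (χ : Additive (PontryaginDual X)) (x : X) :
    (dualRepresentation Γ X g χ).toMul x = χ.toMul (g⁻¹ • x) :=
  rfl

/-- The Pontryagin dual of `X` as a left module over the group ring `ℤΓ`: it is the `ℤΓ`-module
of the representation of `Γ` on the dual group. -/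
abbrev DualModule : Type _ := (dualRepresentation Γ X).asModule

end DualModule

/-!
The dual of an expansive algebraic action with the pseudo-orbit tracing property is finitely
presented over the group ring `ℤΓ`.

Pontryagin duality for compact abelian groups is developed as far as it is needed. Characters
separate points (`exists_pontryaginDual_apply_ne_one`): a continuous function `f` on the group `G`
acts on `L²(G)` by smearing the regular representation, these operators generate a commutative
C⋆-algebra, and a character `φ` of that algebra gives the character
`y ↦ φ (T (y • f)) / φ (T f)` of `G`. By Stone–Weierstrass and orthogonality, a group of characters
that separates points is the whole dual, and therefore every homomorphism from the dual to the
circle is evaluation at a point (`exists_eq_pontryaginDual_apply`).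

By expansiveness there are finitely many characters `E` and a constant `c > 0` such that a point
whose orbit stays within `c` of `1` under all characters in `E` equals `1`. Hence the `ℤΓ`-module
that `E` generates separates points, and is the dual.

Let `π : P → X̂` be the corresponding surjection from a free module. The points of `X` are the
homomorphisms `P → Circle` trivial on `ker π`, and the larger groups of homomorphisms trivial on
finitely generated `J ≤ ker π` decrease to `X`. Two compactness arguments transfer the dynamics to
these groups for some `J`.
* Expansiveness (`exists_fg_forall_eq_one_of_expansive`): a homomorphism trivial on `J` that stays
  within `c` of `1` along the orbits of the generators stays within `c / 2`, so its square again
  stays within `c`. All its iterated squares stay near `1`, and it is trivial.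
* Tracing (`exists_fg_forall_exists_dist_dualPairing_le`): the translates of a homomorphism `y`
  trivial on `J` are approximated on a finite window by points of `X`. These points form a
  pseudo-orbit, and a point that traces it is uniformly close to `y`.

Together, every homomorphism trivial on a suitable finitely generated `J` is a point of `X`, so it
is trivial on `ker π`. Since circle-valued homomorphisms separate the submodules of `P`,
`ker π = J` is finitely generated (`ker_fg_of_hasPseudoOrbitTracing`).
-/

open MeasureTheory Topology Filter ComplexConjugate

/-! ### Characters of a commutative family of operators -/

/-- A set of pairwise commuting elements of a C⋆-algebra, closed under `star`, lies in a
subalgebra `B` with enough continuous characters: any nonzero element of the set is detected by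
some character of `B`. -/
theorem exists_character_apply_ne_zero_of_commute {A : Type*} [CStarAlgebra A] {s : Set A}
    (hs : ∀ a ∈ s, ∀ b ∈ s, a * b = b * a) (hstar : ∀ a ∈ s, star a ∈ s)
    {a : A} (ha : a ∈ s) (ha0 : a ≠ 0) :
    ∃ (B : StarSubalgebra ℂ A) (hB : s ⊆ B) (φ : B →ₐ[ℂ] ℂ),
      Continuous φ ∧ φ ⟨a, hB ha⟩ ≠ 0 := by
  have hc : IsMulCommutative (StarAlgebra.adjoin ℂ s) :=
    StarAlgebra.isMulCommutative_adjoin ℂ hs fun a ha b hb => hs a ha _ (hstar b hb)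
  let B := (StarAlgebra.adjoin ℂ s).topologicalClosure
  have hB : s ⊆ B := (StarAlgebra.subset_adjoin ℂ s).trans
    (StarSubalgebra.le_topologicalClosure _)
  have hcl : IsClosed (B : Set A) := StarSubalgebra.isClosed_topologicalClosure _
  let _ : CommCStarAlgebra B :=
    { (inferInstance : CStarAlgebra B) with
      mul_comm := (StarSubalgebra.commRingTopologicalClosure (StarAlgebra.adjoin ℂ s)
        (fun x y => hc.is_comm.comm x y)).mul_comm }
  by_contra! h
  have h0 : WeakDual.gelfandTransform ℂ B ⟨a, hB ha⟩ = 0 := by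
    ext φ
    exact h B hB (WeakDual.CharacterSpace.toAlgHom φ)
      (map_continuous φ)
  have := (gelfandTransform_isometry B).injective (h0.trans (map_zero _).symm)
  exact ha0 (congrArg Subtype.val this)

/-! ### Smearing a unitary representation of a compact abelian group -/

section Smear

variable {G H : Type*} [TopologicalSpace G] [CommGroup G] [CompactSpace G]
  [MeasurableSpace G] [BorelSpace G] {μ : Measure G} [μ.IsHaarMeasure]
  [NormedAddCommGroup H] [InnerProductSpace ℂ H] {U : G →* (H ≃ₗᵢ[ℂ] H)}

theorem unitary_mul_apply {G : Type*} [CommGroup G] {U : G →* (H ≃ₗᵢ[ℂ] H)} (x y : G) (u : H) :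
    U (x * y) u = U x (U y u) := by
  rw [map_mul]
  rfl

theorem inner_unitary_left {G : Type*} [CommGroup G] {U : G →* (H ≃ₗᵢ[ℂ] H)} (x : G) (u v : H) :
    inner ℂ (U x u) v = inner ℂ u (U x⁻¹ v) := by
  rw [← LinearIsometryEquiv.inner_map_map (U x) u, ← unitary_mul_apply,
    mul_inv_cancel, map_one, LinearIsometryEquiv.coe_one, id]

theorem integrable_smul_unitary (hU : ∀ u, Continuous fun g => U g u) (f : C(G, ℂ)) (u : H) :
    Integrable (fun y => f y • U y u) μ :=
  ((map_continuous f).smul (hU u)).integrable_of_hasCompactSupport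
    (HasCompactSupport.of_compactSpace _)

/-- The operator `u ↦ ∫ f(y) U_y u dμ(y)` that a strongly continuous unitary representation `U`
attaches to a continuous function `f`. -/
noncomputable def smear (μ : Measure G) [μ.IsHaarMeasure] (hU : ∀ u, Continuous fun g => U g u)
    (f : C(G, ℂ)) : H →L[ℂ] H :=
  LinearMap.mkContinuous
    { toFun := fun u => ∫ y, f y • U y u ∂μ
      map_add' := fun u v => by
        simp only [map_add, smul_add]
        exact integral_add (integrable_smul_unitary hU f u) (integrable_smul_unitary hU f v)
      map_smul' := fun c u => by
        simp only [map_smul, RingHom.id_apply]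
        rw [← integral_smul]
        simp only [smul_comm c] }
    (‖f‖ * μ.real Set.univ) fun u => by
      refine (norm_integral_le_of_norm_le_const (C := ‖f‖ * ‖u‖)
        (Eventually.of_forall fun y => ?_)).trans (le_of_eq (by ring))
      rw [norm_smul, LinearIsometryEquiv.norm_map]
      gcongr
      exact f.norm_coe_le_norm y

variable (hU : ∀ u, Continuous fun g => U g u)

theorem smear_apply (f : C(G, ℂ)) (u : H) : smear μ hU f u = ∫ y, f y • U y u ∂μ := rfl

theorem norm_smear_le (f : C(G, ℂ)) : ‖smear μ hU f‖ ≤ ‖f‖ * μ.real Set.univ :=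
  LinearMap.mkContinuous_norm_le _ (by positivity) _

theorem smear_sub (f g : C(G, ℂ)) : smear μ hU (f - g) = smear μ hU f - smear μ hU g := by
  ext u
  simp only [smear_apply, sub_apply, ContinuousMap.sub_apply, sub_smul]
  exact integral_sub (integrable_smul_unitary hU f u) (integrable_smul_unitary hU g u)

theorem continuous_smear : Continuous (smear μ hU) := by
  refine (LipschitzWith.of_dist_le_mul (K := (μ.real Set.univ).toNNReal) fun f g => ?_).continuous
  rw [dist_eq_norm, dist_eq_norm, ← smear_sub, Real.coe_toNNReal _ measureReal_nonneg, mul_comm]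
  exact norm_smear_le hU _

variable [CompleteSpace H]

theorem unitary_smear (x : G) (f : C(G, ℂ)) (u : H) :
    U x (smear μ hU f u) = smear μ hU f (U x u) := by
  refine ((U x).toContinuousLinearEquiv.toContinuousLinearMap.integral_comp_comm
      (integrable_smul_unitary hU f u)).symm.trans ?_
  refine integral_congr_ae (Eventually.of_forall fun y => ?_)
  change U x (f y • U y u) = f y • U y (U x u)
  rw [map_smul, ← unitary_mul_apply, ← unitary_mul_apply, mul_comm]

theorem smear_mul_comm (f g : C(G, ℂ)) :
    smear μ hU f * smear μ hU g = smear μ hU g * smear μ hU f := by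
  ext u
  change smear μ hU f (smear μ hU g u) = smear μ hU g (smear μ hU f u)
  conv_lhs => rw [smear_apply hU g u]
  rw [← (smear μ hU f).integral_comp_comm (integrable_smul_unitary hU g u), smear_apply hU g]
  refine integral_congr_ae (Eventually.of_forall fun y => ?_)
  simp only [map_smul, unitary_smear]

theorem inner_smear (f : C(G, ℂ)) (u v : H) :
    inner ℂ v (smear μ hU f u) = ∫ y, f y * inner ℂ v (U y u) ∂μ := by
  rw [smear_apply, ← integral_inner (integrable_smul_unitary hU f u)]
  simp only [inner_smul_right]

variable [IsTopologicalGroup G]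

theorem unitary_smear_eq (x : G) (f : C(G, ℂ)) (u : H) :
    U x (smear μ hU f u) = smear μ hU (f.comp (ContinuousMap.mulLeft x⁻¹)) u := by
  refine ((U x).toContinuousLinearEquiv.toContinuousLinearMap.integral_comp_comm
      (integrable_smul_unitary hU f u)).symm.trans ?_
  rw [smear_apply,
    ← integral_mul_left_eq_self (fun y => (f.comp (ContinuousMap.mulLeft x⁻¹)) y • U y u) x]
  refine integral_congr_ae (Eventually.of_forall fun y => ?_)
  change U x (f y • U y u) = f (x⁻¹ * (x * y)) • U (x * y) u
  rw [map_smul, unitary_mul_apply, inv_mul_cancel_left]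

/-- Translating one factor of a product of smearing operators is the same as translating the
other. -/
theorem smear_translate_mul (x : G) (f g : C(G, ℂ)) :
    smear μ hU (f.comp (ContinuousMap.mulLeft x⁻¹)) * smear μ hU g =
      smear μ hU f * smear μ hU (g.comp (ContinuousMap.mulLeft x⁻¹)) := by
  ext u
  change smear μ hU (f.comp (ContinuousMap.mulLeft x⁻¹)) (smear μ hU g u) =
    smear μ hU f (smear μ hU (g.comp (ContinuousMap.mulLeft x⁻¹)) u)
  rw [← unitary_smear_eq, ← unitary_smear_eq, unitary_smear]

theorem star_smear (f : C(G, ℂ)) :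
    star (smear μ hU f) = smear μ hU (star (f.comp ⟨_, continuous_inv⟩)) := by
  rw [ContinuousLinearMap.star_eq_adjoint, eq_comm, ContinuousLinearMap.eq_adjoint_iff]
  intro u v
  rw [← inner_conj_symm, inner_smear, inner_smear, ← integral_conj,
    ← integral_inv_eq_self]
  refine integral_congr_ae (Eventually.of_forall fun y => ?_)
  have h := inner_unitary_left (U := U) y⁻¹ u v
  rw [inv_inv] at h
  simp only [ContinuousMap.star_apply, ContinuousMap.comp_apply, ContinuousMap.coe_mk, inv_inv,
    map_mul, inner_conj_symm, h, RCLike.star_def, Complex.conj_conj]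

/-- If smearing does not see the translation by `x`, then `U x` is trivial. -/
theorem unitary_eq_self_of_smear_translate_eq {x : G}
    (h : ∀ f : C(G, ℂ), smear μ hU (f.comp (ContinuousMap.mulLeft x⁻¹)) = smear μ hU f) (u : H) :
    U x u = u := by
  -- Test the hypothesis on the matrix coefficient `y ↦ ⟪w, U y w⟫` with `w = U x⁻¹ u - u`.
  have key : ∀ v w : H, ∀ f : C(G, ℂ), ∫ y, f y * inner ℂ (U x⁻¹ v - v) (U y w) ∂μ = 0 := by
    intro v w f
    have h1 := congrArg (fun T => inner ℂ v (T w)) (h f)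
    simp only [← unitary_smear_eq] at h1
    have h2 : inner ℂ (U x⁻¹ v - v) (smear μ hU f w) = 0 := by
      rw [inner_sub_left, inner_unitary_left, inv_inv, h1, sub_self]
    rwa [inner_smear] at h2
  set w := U x⁻¹ u - u with hw
  let k : C(G, ℂ) := ⟨fun y => inner ℂ w (U y w), continuous_const.inner (hU w)⟩
  have h3 : ∫ y, ‖k y‖ ^ 2 ∂μ = 0 := by
    have h0 := key u w (star k)
    have h1 : ∫ y, ((‖k y‖ ^ 2 : ℝ) : ℂ) ∂μ = 0 := by
      rw [← h0]
      refine integral_congr_ae (Eventually.of_forall fun y => ?_)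
      change ((‖k y‖ ^ 2 : ℝ) : ℂ) = conj (k y) * k y
      rw [Complex.conj_mul']
      push_cast
      rfl
    rw [integral_complex_ofReal] at h1
    exact_mod_cast h1
  have hk : Continuous fun y => ‖k y‖ ^ 2 := by fun_prop
  have h4 := (hk.integral_pos_of_hasCompactSupport_nonneg_nonzero (μ := μ) (x := 1)
    (HasCompactSupport.of_compactSpace _) (fun y => by positivity)).mt h3.not_gt
  have h5 : inner ℂ w w = (0 : ℂ) := by
    have : k 1 = 0 := by simpa using h4
    simpa [k] using this
  have h6 : w = 0 := inner_self_eq_zero.1 h5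
  have h7 : U x⁻¹ u = u := sub_eq_zero.1 (hw ▸ h6)
  conv_lhs => rw [← h7]
  rw [← unitary_mul_apply, mul_inv_cancel, map_one, LinearIsometryEquiv.coe_one, id]

theorem continuous_translate {G : Type*} [TopologicalSpace G] [CommGroup G] [IsTopologicalGroup G]
    (f : C(G, ℂ)) : Continuous fun x : G => f.comp (ContinuousMap.mulLeft x⁻¹) :=
  ContinuousMap.continuous_of_continuous_uncurry _ (by
    change Continuous fun p : G × G => f (p.1⁻¹ * p.2)
    fun_prop)

/-- A continuous homomorphism from a compact group to the multiplicative monoid `ℂ` has values on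
the unit circle, because its powers are bounded. -/
theorem norm_map_eq_one_of_compactSpace {G : Type*} [TopologicalSpace G] [Group G]
    [CompactSpace G] (c : G →* ℂ) (hc : Continuous c) (y : G) : ‖c y‖ = 1 := by
  obtain ⟨C, hC⟩ := isCompact_univ.exists_bound_of_continuousOn hc.continuousOn
  have le : ∀ y, ‖c y‖ ≤ 1 := by
    intro y
    by_contra! h
    obtain ⟨n, hn⟩ := pow_unbounded_of_one_lt C h
    have := hC (y ^ n) trivial
    rw [map_pow, norm_pow] at this
    linarith
  have h1 : ‖c y‖ * ‖c y⁻¹‖ = 1 := by rw [← norm_mul, ← map_mul]; simp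
  nlinarith [le y, le y⁻¹, norm_nonneg (c y), norm_nonneg (c y⁻¹)]

/-- A strongly continuous unitary representation of a compact abelian group is nontrivial only on
elements that some continuous character detects. -/
theorem exists_pontryaginDual_apply_ne_one_of_unitary (μ : Measure G) [μ.IsHaarMeasure]
    (hU : ∀ u, Continuous fun g => U g u) {x : G} {u : H} (hx : U x u ≠ u) :
    ∃ χ : PontryaginDual G, χ x ≠ 1 := by
  have hex : ∃ f : C(G, ℂ), smear μ hU (f.comp (ContinuousMap.mulLeft x⁻¹)) ≠ smear μ hU f := by
    by_contra! h
    exact hx (unitary_eq_self_of_smear_translate_eq hU h u)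
  obtain ⟨f, hf⟩ := hex
  obtain ⟨B, hB, φ, hφ, hne⟩ := exists_character_apply_ne_zero_of_commute
    (s := Set.range (smear μ hU)) (a := smear μ hU (f.comp (ContinuousMap.mulLeft x⁻¹) - f))
    (by rintro _ ⟨f, rfl⟩ _ ⟨g, rfl⟩; exact smear_mul_comm hU f g)
    (by rintro _ ⟨f, rfl⟩; exact ⟨_, (star_smear hU f).symm⟩)
    ⟨_, rfl⟩ (by rwa [smear_sub, sub_ne_zero])
  let Φ : C(G, ℂ) → ℂ := fun f => φ ⟨smear μ hU f, hB ⟨f, rfl⟩⟩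
  let τ : G → C(G, ℂ) → C(G, ℂ) := fun y f => f.comp (ContinuousMap.mulLeft y⁻¹)
  have hΦ : Continuous Φ := hφ.comp ((continuous_smear hU).subtype_mk _)
  have hsub : Φ (τ x f - f) = Φ (τ x f) - Φ f := by
    simp only [Φ]
    rw [← map_sub]
    exact congrArg φ (Subtype.ext (smear_sub hU _ _))
  have hmul : ∀ y f g, Φ (τ y f) * Φ g = Φ f * Φ (τ y g) := by
    intro y f g
    simp only [Φ]
    rw [← map_mul, ← map_mul]
    exact congrArg φ (Subtype.ext (smear_translate_mul hU y f g))
  have hττ : ∀ y z, τ (y * z) f = τ y (τ z f) := by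
    intro y z
    ext w
    simp only [τ, ContinuousMap.comp_apply, ContinuousMap.coe_mulLeft]
    rw [mul_inv, mul_comm y⁻¹, mul_assoc]
  have h0 : Φ f ≠ 0 := by
    intro h0
    have h1 := hmul x f (τ x f)
    rw [h0, zero_mul, mul_self_eq_zero] at h1
    exact hne (hsub.trans (by rw [h1, h0, sub_zero]))
  -- Translating any function by `y` multiplies `Φ` by one and the same factor `c y`.
  let c : G →* ℂ :=
    { toFun := fun y => Φ (τ y f) / Φ f
      map_one' := by
        have : τ 1 f = f := by ext w; simp [τ]
        rw [this, div_self h0]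
      map_mul' := fun y z => by
        have h1 := hmul y (τ z f) f
        rw [hττ]
        field_simp
        rw [h1, mul_comm] }
  have hc : Continuous c := (hΦ.comp (continuous_translate f)).div_const _
  let χ : G →ₜ* Circle :=
    { toFun := fun y => ⟨c y, mem_sphere_zero_iff_norm.2 (norm_map_eq_one_of_compactSpace c hc y)⟩
      map_one' := Subtype.ext (map_one c)
      map_mul' := fun y z => Subtype.ext (map_mul c y z)
      continuous_toFun := hc.subtype_mk _ }
  refine ⟨χ, fun h => hne (hsub.trans ?_)⟩
  have h1 : Φ (τ x f) / Φ f = 1 := congrArg (Subtype.val) h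
  rw [(div_eq_one_iff_eq h0).1 h1, sub_self]

end Smear

/-! ### Characters separate points -/

section Regular

open DomMulAct ENNReal

variable {G : Type*} [TopologicalSpace G] [CommGroup G] [IsTopologicalGroup G] [CompactSpace G]
  [T2Space G]

/-- Continuous characters separate the points of a compact Hausdorff abelian group. -/
theorem exists_pontryaginDual_apply_ne_one {x : G} (hx : x ≠ 1) :
    ∃ χ : PontryaginDual G, χ x ≠ 1 := by
  let _ : MeasurableSpace G := borel G
  have _ : BorelSpace G := ⟨rfl⟩
  let μ : Measure G := Measure.haarMeasure ⊤
  have : Fact ((2 : ℝ≥0∞) ≠ ∞) := ⟨by simp⟩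
  -- The regular representation of `G` on `L²(G)`, by translations.
  let U : G →* (Lp ℂ 2 μ ≃ₗᵢ[ℂ] Lp ℂ 2 μ) :=
    { toFun := fun g =>
        { DistribMulAction.toLinearEquiv ℂ (Lp ℂ 2 μ) (DomMulAct.mk g) with
          norm_map' := fun u => norm_smul_Lp _ u }
      map_one' := by
        ext1 u
        exact one_smul Gᵈᵐᵃ u
      map_mul' := fun g h => by
        ext1 u
        change DomMulAct.mk (g * h) • u = DomMulAct.mk g • DomMulAct.mk h • u
        rw [mul_comm, smul_smul]
        rfl }
  have hU : ∀ u, Continuous fun g => U g u := fun u => by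
    change Continuous fun g : G => DomMulAct.mk g • u
    have : Continuous (DomMulAct.mk : G → Gᵈᵐᵃ) := DomMulAct.continuous_mk
    fun_prop
  obtain ⟨f, hf⟩ : ∃ f : C(G, ℂ), f x ≠ f 1 := by
    obtain ⟨f, h0, h1, -⟩ := exists_continuous_zero_one_of_isClosed
      (isClosed_singleton (x := x)) (isClosed_singleton (x := (1 : G))) (by simpa using hx)
    refine ⟨⟨fun y => (f y : ℂ), by fun_prop⟩, ?_⟩
    have h0 := h0 rfl
    have h1 := h1 rfl
    simp_all
  have hmem : ∀ f : C(G, ℂ), MemLp f 2 μ := fun f =>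
    (map_continuous f).memLp_of_hasCompactSupport (HasCompactSupport.of_compactSpace _)
  refine exists_pontryaginDual_apply_ne_one_of_unitary (U := U) μ hU (u := (hmem f).toLp f) ?_
  intro h
  change DomMulAct.mk x • (hmem f).toLp f = _ at h
  rw [mk_smul_toLp, MemLp.toLp_eq_toLp_iff] at h
  have h2 := (Continuous.ae_eq_iff_eq μ (by fun_prop) (by fun_prop)).1 h
  exact hf (by simpa using congrFun h2 1)

end Regular

/-! ### Pontryagin duality for compact abelian groups -/

section Duality

variable {G : Type*} [TopologicalSpace G] [CommGroup G]

/-- A character as a complex-valued continuous function. -/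
noncomputable def characterToComplex : PontryaginDual G →* C(G, ℂ) where
  toFun χ := ⟨fun x => χ x, by fun_prop⟩
  map_one' := rfl
  map_mul' _ _ := rfl

@[simp]
theorem characterToComplex_apply (χ : PontryaginDual G) (x : G) :
    characterToComplex χ x = χ x := rfl

variable [IsTopologicalGroup G]

theorem integral_character_eq_zero [MeasurableSpace G] [BorelSpace G] (μ : Measure G)
    [μ.IsHaarMeasure] {χ : PontryaginDual G} (hχ : χ ≠ 1) : ∫ x, (χ x : ℂ) ∂μ = 0 := by
  obtain ⟨x, hx⟩ : ∃ x, χ x ≠ 1 := by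
    by_contra! h
    exact hχ (PontryaginDual.ext h)
  have h := integral_mul_left_eq_self (μ := μ) (fun y => (χ y : ℂ)) x
  simp only [map_mul, Circle.coe_mul, integral_const_mul] at h
  by_contra h0
  exact hx (Circle.ext (mul_right_cancel₀ h0 (by simpa using h)))

variable [CompactSpace G]

/-- A group of characters that separates the points contains every character: by
Stone–Weierstrass its span is dense, and a character outside of it would be orthogonal to that
span. -/
theorem subgroup_pontryaginDual_eq_top_of_separates {N : Subgroup (PontryaginDual G)}
    (hN : ∀ x : G, (∀ χ ∈ N, χ x = 1) → x = 1) : N = ⊤ := by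
  let _ : MeasurableSpace G := borel G
  have _ : BorelSpace G := ⟨rfl⟩
  let μ : Measure G := Measure.haarMeasure ⊤
  rw [eq_top_iff]
  intro ψ _
  by_contra hψ
  let S : Submonoid C(G, ℂ) := N.toSubmonoid.map characterToComplex
  have hstar : ∀ f ∈ S, star f ∈ S := by
    rintro _ ⟨χ, hχ, rfl⟩
    refine ⟨χ⁻¹, N.inv_mem hχ, ?_⟩
    ext x
    exact Circle.coe_inv_eq_conj (χ x)
  let A : StarSubalgebra ℂ C(G, ℂ) := StarAlgebra.adjoin ℂ (S : Set C(G, ℂ))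
  have hspan : ∀ f ∈ A, f ∈ Submodule.span ℂ (S : Set C(G, ℂ)) := by
    intro f hf
    have h1 : (S : Set C(G, ℂ)) ∪ star (S : Set C(G, ℂ)) = S := by
      refine Set.union_eq_left.2 fun f hf => ?_
      simpa using hstar _ hf
    have h2 : f ∈ Algebra.adjoin ℂ (S : Set C(G, ℂ)) := by
      rw [← h1]
      exact hf
    rw [← Subalgebra.mem_toSubmodule, Algebra.adjoin_eq_span, Submonoid.closure_eq] at h2
    exact h2
  have hA : A.topologicalClosure = ⊤ := by
    refine ContinuousMap.starSubalgebra_topologicalClosure_eq_top_of_separatesPoints A ?_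
    intro x y hxy
    have : ∃ χ ∈ N, χ (x / y) ≠ 1 := by
      by_contra! h
      exact hxy (div_eq_one.1 (hN _ h))
    obtain ⟨χ, hχ, hne⟩ := this
    refine ⟨_, ⟨characterToComplex χ, StarAlgebra.subset_adjoin ℂ _ ⟨χ, hχ, rfl⟩, rfl⟩, ?_⟩
    intro h
    rw [map_div] at hne
    exact hne (div_eq_one.2 (Circle.ext h))
  have hint : ∀ f : C(G, ℂ), Integrable f μ := fun f =>
    (map_continuous f).integrable_of_hasCompactSupport (HasCompactSupport.of_compactSpace _)
  -- Integration against `conj ψ` vanishes on the span of `N`, hence on all continuous functions.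
  let L : C(G, ℂ) →ₗ[ℂ] ℂ :=
    { toFun := fun f => ∫ x, (f * characterToComplex ψ⁻¹) x ∂μ
      map_add' := fun f g => by
        rw [← integral_add (hint _) (hint _)]
        simp [add_mul]
      map_smul' := fun c f => by
        rw [RingHom.id_apply, ← integral_smul]
        simp }
  have hLc : Continuous L := by
    refine AddMonoidHomClass.continuous_of_bound L (μ.real Set.univ) fun f => ?_
    refine (norm_integral_le_of_norm_le_const (C := ‖f‖)
      (Eventually.of_forall fun x => ?_)).trans (le_of_eq (mul_comm _ _))
    rw [ContinuousMap.mul_apply, norm_mul, characterToComplex_apply, Circle.norm_coe, mul_one]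
    exact f.norm_coe_le_norm x
  have hL0 : ∀ f ∈ A, L f = 0 := by
    intro f hf
    have hf' := hspan f hf
    clear hf
    induction hf' using Submodule.span_induction with
    | mem f hf =>
      obtain ⟨χ, hχ, rfl⟩ := hf
      change ∫ x, (characterToComplex χ * characterToComplex ψ⁻¹) x ∂μ = 0
      rw [← map_mul]
      change ∫ x, ((χ * ψ⁻¹) x : ℂ) ∂μ = 0
      refine integral_character_eq_zero μ fun h => hψ ?_
      rw [← mul_inv_eq_one.1 h]
      exact hχ
    | zero => exact map_zero L
    | add f g _ _ hf hg => rw [map_add, hf, hg, add_zero]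
    | smul c f _ hf => rw [map_smul, hf, smul_zero]
  have hclosed : IsClosed {f | L f = 0} := isClosed_eq hLc continuous_const
  have h1 : characterToComplex ψ ∈ {f | L f = 0} := by
    refine closure_minimal hL0 hclosed ?_
    rw [← StarSubalgebra.topologicalClosure_coe, hA]
    trivial
  change ∫ x, (characterToComplex ψ * characterToComplex ψ⁻¹) x ∂μ = 0 at h1
  rw [← map_mul, mul_inv_cancel, map_one] at h1
  simp only [ContinuousMap.one_apply, integral_const, mul_one, Complex.real_smul,
    Complex.ofReal_eq_zero] at h1
  exact (measureReal_univ_pos (μ := μ)).ne' h1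

end Duality

section DoubleDual

variable {G : Type*} [TopologicalSpace G] [CommGroup G] [CompactSpace G]

/-- Evaluation at the points of `G`, from `G` to its double dual. -/
noncomputable def doubleDualEvaluation : G →ₜ* PontryaginDual (PontryaginDual G) where
  toFun x :=
    { toFun := fun χ => χ x
      map_one' := rfl
      map_mul' := fun _ _ => rfl
      continuous_toFun := continuous_of_discreteTopology }
  map_one' := PontryaginDual.ext fun χ => map_one χ
  map_mul' x y := PontryaginDual.ext fun χ => map_mul χ x y
  continuous_toFun := ContinuousMonoidHom.continuous_of_continuous_uncurry _ <|
    continuous_prod_of_discrete_right.2 fun χ => map_continuous χ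

/-- Every homomorphism from the dual of a compact abelian group to the circle is evaluation at
a point. The image of `G` in its double dual is closed; a character of the double dual that is
trivial on this image is evaluation at a character of `G`, and that character is trivial. -/
theorem exists_eq_pontryaginDual_apply (l : PontryaginDual G →* Circle) :
    ∃ x : G, ∀ χ : PontryaginDual G, χ x = l χ := by
  let D := PontryaginDual (PontryaginDual G)
  let H : Subgroup D := (doubleDualEvaluation (G := G)).toMonoidHom.range
  have hH : IsClosed (H : Set D) :=
    (isCompact_range (map_continuous (doubleDualEvaluation (G := G)))).isClosed
  let ev : PontryaginDual G →* PontryaginDual D :=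
    { toFun := fun χ =>
        { toFun := fun d => d χ
          map_one' := rfl
          map_mul' := fun _ _ => rfl
          continuous_toFun :=
            (continuous_eval_const χ : Continuous fun d : PontryaginDual G →ₜ* Circle => d χ) }
      map_one' := PontryaginDual.ext fun d => map_one d
      map_mul' := fun χ ψ => PontryaginDual.ext fun d => map_mul d χ ψ }
  have htop : ev.range = ⊤ := subgroup_pontryaginDual_eq_top_of_separates fun d hd =>
    PontryaginDual.ext fun χ => hd _ ⟨χ, rfl⟩
  let d : D :=
    { l with continuous_toFun := continuous_of_discreteTopology }
  by_cases hd : d ∈ H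
  · obtain ⟨x, hx⟩ := hd
    exact ⟨x, fun χ => DFunLike.congr_fun hx χ⟩
  · exfalso
    have hne : (d : D ⧸ H) ≠ 1 := fun h => hd ((QuotientGroup.eq_one_iff d).1 h)
    obtain ⟨Ψ, hΨ⟩ := exists_pontryaginDual_apply_ne_one hne
    let q : D →ₜ* D ⧸ H :=
      { QuotientGroup.mk' H with continuous_toFun := continuous_quot_mk }
    obtain ⟨χ, hχ⟩ : PontryaginDual.map q Ψ ∈ ev.range := htop ▸ trivial
    have hχ1 : χ = 1 := PontryaginDual.ext fun x => by
      have h1 : ev χ (doubleDualEvaluation x) = 1 := by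
        rw [hχ, PontryaginDual.map_apply]
        have : q (doubleDualEvaluation x) = 1 := (QuotientGroup.eq_one_iff _).2 ⟨x, rfl⟩
        rw [this, map_one]
      exact h1
    apply hΨ
    change PontryaginDual.map q Ψ d = 1
    rw [← hχ, hχ1, map_one, PontryaginDual.one_apply]

end DoubleDual

/-! ### Circle-valued homomorphisms on a module -/

section CircleHoms

/-- The homomorphisms from the additive group `P` to the multiplicative circle group, as a set of
functions, so that it carries the topology of pointwise convergence. -/
def circleHoms (P : Type*) [Add P] : Set (P → Circle) := {y | ∀ a b, y (a + b) = y a * y b}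

theorem isClosed_circleHoms (P : Type*) [Add P] : IsClosed (circleHoms P) := by
  simp only [circleHoms, Set.ofPred_forall]
  exact isClosed_iInter fun a => isClosed_iInter fun b =>
    isClosed_eq (by fun_prop) (by fun_prop)

variable {P : Type*} [AddCommGroup P] {y : P → Circle}

theorem circleHoms_zsmul (hy : y ∈ circleHoms P) (n : ℤ) (a : P) : y (n • a) = y a ^ n :=
  map_zpow (MonoidHom.mk' (fun p : Multiplicative P => y p.toAdd) fun _ _ => hy _ _)
    (Multiplicative.ofAdd a) n

theorem circleHoms_zero (hy : y ∈ circleHoms P) : y 0 = 1 := by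
  simpa using circleHoms_zsmul hy 0 0

theorem circleHoms_div {z : P → Circle} (hy : y ∈ circleHoms P) (hz : z ∈ circleHoms P) :
    (fun p => y p / z p) ∈ circleHoms P := fun a b => by
  simp only [hy a b, hz a b, mul_div_mul_comm]

theorem circleHoms_sq (hy : y ∈ circleHoms P) : (fun p => y p ^ 2) ∈ circleHoms P := fun a b => by
  simp only [hy a b, mul_pow]

theorem circleHoms_smul {R : Type*} [Semiring R] [Module R P] (hy : y ∈ circleHoms P) (r : R) :
    (fun p => y (r • p)) ∈ circleHoms P := fun a b => by
  simp only [smul_add, hy (r • a)]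

/-- Compactness: a property that is open inside a closed set and holds for every homomorphism
trivial on `J` already holds for the homomorphisms trivial on some finitely generated part
of `J`. -/
theorem exists_fg_forall_circleHoms {R : Type*} [Semiring R] [Module R P] (J : Submodule R P)
    {C U : Set (P → Circle)} (hC : IsClosed C) (hU : IsOpen U)
    (h : ∀ y ∈ circleHoms P, (∀ a ∈ J, y a = 1) → y ∈ C → y ∈ U) :
    ∃ J' ≤ J, J'.FG ∧ ∀ y ∈ circleHoms P, (∀ a ∈ J', y a = 1) → y ∈ C → y ∈ U := by
  classical
  have hK : IsCompact ((circleHoms P ∩ C) \ U) :=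
    (((isClosed_circleHoms P).inter hC).inter hU.isClosed_compl).isCompact
  obtain ⟨u, hu⟩ := hK.elim_finite_subfamily_closed (fun a : J => {y : P → Circle | y a = 1})
    (fun a => isClosed_eq (continuous_apply _) continuous_const) (by
      rw [Set.eq_empty_iff_forall_notMem]
      rintro y ⟨⟨⟨hy, hyC⟩, hyU⟩, hyJ⟩
      exact hyU (h y hy (fun a ha => Set.mem_iInter.1 hyJ ⟨a, ha⟩) hyC))
  refine ⟨Submodule.span R (u.image Subtype.val : Finset P), Submodule.span_le.2 ?_, ⟨_, rfl⟩, ?_⟩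
  · intro a ha
    obtain ⟨b, -, rfl⟩ := Finset.mem_image.1 (Finset.mem_coe.1 ha)
    exact b.2
  · intro y hy hy1 hyC
    by_contra hyU
    refine Set.eq_empty_iff_forall_notMem.1 hu y ⟨⟨⟨hy, hyC⟩, hyU⟩, ?_⟩
    refine Set.mem_iInter₂.2 fun a ha => hy1 _ (Submodule.subset_span ?_)
    exact Finset.mem_coe.2 (Finset.mem_image_of_mem _ ha)

/-- Circle-valued homomorphisms trivial on a submodule detect the elements outside of it. -/
theorem exists_circleHoms_apply_ne_one {R : Type*} [Ring R] [Module R P] {J : Submodule R P}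
    {a : P} (ha : a ∉ J) : ∃ y ∈ circleHoms P, (∀ b ∈ J, y b = 1) ∧ y a ≠ 1 := by
  have hne : (J.mkQ a) ≠ 0 := fun h => ha ((Submodule.Quotient.mk_eq_zero J).1 h)
  obtain ⟨c, hc⟩ := CharacterModule.exists_character_apply_ne_zero_of_ne_zero hne
  -- The inclusion of `ℚ/ℤ` into `ℝ/ℤ`.
  let i : AddCircle (1 : ℚ) →+ AddCircle (1 : ℝ) :=
    QuotientAddGroup.map _ _ (Rat.castHom ℝ).toAddMonoidHom (by
      rw [AddSubgroup.zmultiples_le]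
      exact ⟨1, by simp⟩)
  have hi : Function.Injective i := by
    rw [injective_iff_map_eq_zero]
    intro q hq
    induction q using QuotientAddGroup.induction_on with
    | H q =>
      obtain ⟨n, hn⟩ := AddCircle.coe_eq_zero_iff (1 : ℝ) |>.1 hq
      refine (AddCircle.coe_eq_zero_iff (1 : ℚ)).2 ⟨n, ?_⟩
      have hn : (n : ℝ) = (q : ℝ) := by simpa using hn
      simpa using (by exact_mod_cast hn : (n : ℚ) = q)
  refine ⟨fun p => AddCircle.toCircle (i (c (J.mkQ p))), fun p q => ?_, fun b hb => ?_, fun h => ?_⟩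
  · simp only [map_add, AddCircle.toCircle_add]
  · have : J.mkQ b = 0 := (Submodule.Quotient.mk_eq_zero J).2 hb
    simp only [this, map_zero, AddCircle.toCircle_zero]
  · rw [← AddCircle.toCircle_zero (T := 1)] at h
    have := AddCircle.injective_toCircle one_ne_zero h
    exact hc (hi (this.trans (map_zero i).symm))

/-- A homomorphism on a `ℤΓ`-module is determined by its values on the `Γ`-orbits of
generators. -/
theorem circleHoms_eq_one_of_span {Γ : Type*} [Group Γ] [Module (MonoidAlgebra ℤ Γ) P] {T : Set P}
    (hT : Submodule.span (MonoidAlgebra ℤ Γ) T = ⊤) (hy : y ∈ circleHoms P)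
    (h : ∀ g : Γ, ∀ t ∈ T, y (MonoidAlgebra.single g (1 : ℤ) • t) = 1) (p : P) : y p = 1 := by
  have key : ∀ p ∈ Submodule.span (MonoidAlgebra ℤ Γ) T, ∀ r : MonoidAlgebra ℤ Γ,
      y (r • p) = 1 := by
    intro p hp
    induction hp using Submodule.span_induction with
    | mem t ht =>
      intro r
      induction r using MonoidAlgebra.induction_linear with
      | zero => rw [zero_smul, circleHoms_zero hy]
      | add f g hf hg => rw [add_smul, hy, hf, hg, one_mul]
      | single g n =>
        have : MonoidAlgebra.single g n = n • MonoidAlgebra.single g (1 : ℤ) := by simp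
        rw [this, smul_assoc, circleHoms_zsmul hy, h g t ht, one_zpow]
    | zero => intro r; rw [smul_zero, circleHoms_zero hy]
    | add a b _ _ ha hb => intro r; rw [smul_add, hy, ha, hb, one_mul]
    | smul s a _ ha => intro r; rw [smul_smul, ha]
  simpa using key p (hT ▸ trivial) 1

theorem Circle.dist_eq_norm_coe_sub (z w : Circle) : dist z w = ‖(z : ℂ) - w‖ :=
  dist_eq_norm (z : ℂ) w

theorem Circle.dist_div_one (z w : Circle) : dist (z / w) 1 = dist z w := by
  have h : ((z / w : Circle) : ℂ) - (1 : Circle) = ((z : ℂ) - w) / w := by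
    push_cast
    rw [sub_div, div_self w.coe_ne_zero]
  rw [dist_eq_norm_coe_sub, dist_eq_norm_coe_sub, h, norm_div, Circle.norm_coe, div_one]

theorem Circle.dist_sq_one_le (z : Circle) : dist (z ^ 2) 1 ≤ 2 * dist z 1 := by
  have h : ((z ^ 2 : Circle) : ℂ) - (1 : Circle) = ((z : ℂ) - 1) * ((z : ℂ) + 1) := by
    push_cast; ring
  rw [dist_eq_norm_coe_sub, dist_eq_norm_coe_sub, h, norm_mul, mul_comm]
  have : ‖(z : ℂ) + 1‖ ≤ 2 := (norm_add_le _ _).trans (by rw [Circle.norm_coe]; norm_num)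
  gcongr
  simp

theorem Circle.mul_dist_le_dist_sq {z : Circle} (hz : dist z 1 ≤ 1 / 2) :
    3 / 2 * dist z 1 ≤ dist (z ^ 2) 1 := by
  have h : ((z ^ 2 : Circle) : ℂ) - (1 : Circle) = ((z : ℂ) - 1) * ((z : ℂ) + 1) := by
    push_cast; ring
  rw [dist_eq_norm_coe_sub] at hz
  rw [dist_eq_norm_coe_sub, dist_eq_norm_coe_sub, h, norm_mul, mul_comm]
  have : 3 / 2 ≤ ‖(z : ℂ) + 1‖ := by
    have h2 : ‖(2 : ℂ)‖ ≤ ‖(z : ℂ) + 1‖ + ‖(z : ℂ) - (1 : Circle)‖ := by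
      refine le_trans (le_of_eq ?_) (norm_sub_le _ _)
      congr 1
      push_cast; ring
    rw [Complex.norm_ofNat] at h2
    linarith
  gcongr
  simp

/-- Points of the circle whose iterated squares all stay near `1` equal `1`. -/
theorem Circle.eq_one_of_forall_dist_pow_le {z : Circle}
    (h : ∀ n : ℕ, dist (z ^ 2 ^ n) 1 ≤ 1 / 2) : z = 1 := by
  have hn : ∀ n : ℕ, (3 / 2 : ℝ) ^ n * dist z 1 ≤ dist (z ^ 2 ^ n) 1 := by
    intro n
    induction n with
    | zero => simp
    | succ n ih =>
      have h1 := Circle.mul_dist_le_dist_sq (h n)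
      rw [← pow_mul, ← pow_succ] at h1
      rw [pow_succ]
      linarith
  by_contra hz
  have hpos : 0 < dist z 1 := dist_pos.2 hz
  obtain ⟨n, hn'⟩ := pow_unbounded_of_one_lt (1 / 2 / dist z 1) (by norm_num : (1 : ℝ) < 3 / 2)
  rw [div_lt_iff₀ hpos] at hn'
  linarith [hn n, h n]

end CircleHoms

/-! ### Points of the group as homomorphisms on a presentation of its dual -/

section Pairing

variable {Γ X : Type*} [Group Γ] [TopologicalSpace X] [CommGroup X]
  [MulDistribMulAction Γ X] [ContinuousConstSMul Γ X]

/-- The value at a point of `X` of an element of the dual module. -/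
noncomputable def dualPairing (m : DualModule Γ X) (x : X) : Circle :=
  ((dualRepresentation Γ X).asModuleEquiv m).toMul x

theorem dualPairing_add (m n : DualModule Γ X) (x : X) :
    dualPairing (m + n) x = dualPairing m x * dualPairing n x := rfl

theorem dualPairing_one (m : DualModule Γ X) : dualPairing m 1 = 1 :=
  map_one ((dualRepresentation Γ X).asModuleEquiv m).toMul

theorem continuous_dualPairing (m : DualModule Γ X) : Continuous (dualPairing m) :=
  map_continuous ((dualRepresentation Γ X).asModuleEquiv m).toMul

theorem dualPairing_single_smul (g : Γ) (m : DualModule Γ X) (x : X) :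
    dualPairing (MonoidAlgebra.single g (1 : ℤ) • m) x = dualPairing m (g⁻¹ • x) := by
  rw [Representation.single_smul, one_smul]
  rfl

theorem dualPairing_smul (g : Γ) (m : DualModule Γ X) (x : X) :
    dualPairing m (g • x) = dualPairing (MonoidAlgebra.single g⁻¹ (1 : ℤ) • m) x := by
  rw [dualPairing_single_smul, inv_inv]

variable {P : Type*} [AddCommGroup P] [Module (MonoidAlgebra ℤ Γ) P]
  {π : P →ₗ[MonoidAlgebra ℤ Γ] DualModule Γ X}

theorem dualPairing_mem_circleHoms (π : P →ₗ[MonoidAlgebra ℤ Γ] DualModule Γ X) (x : X) :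
    (fun p => dualPairing (π p) x) ∈ circleHoms P := fun a b => by
  simp only [map_add, dualPairing_add]

variable [CompactSpace X]

/-- The homomorphisms on `P` that factor through the dual module are the points of `X`. -/
theorem exists_eq_dualPairing (hπ : Function.Surjective π) {y : P → Circle}
    (hy : y ∈ circleHoms P) (hker : ∀ a ∈ LinearMap.ker π, y a = 1) :
    ∃ x : X, ∀ p, y p = dualPairing (π p) x := by
  have hfac : ∀ p q, π p = π q → y p = y q := by
    intro p q h
    have h1 : y (p - q) = 1 := hker _ (by rw [LinearMap.mem_ker, map_sub, h, sub_self])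
    have h2 := hy (p - q) q
    rwa [sub_add_cancel, h1, one_mul] at h2
  let e := (dualRepresentation Γ X).asModuleEquiv
  let r : DualModule Γ X → P := Function.surjInv hπ
  have hr : ∀ m, π (r m) = m := Function.surjInv_eq hπ
  obtain ⟨x, hx⟩ := exists_eq_pontryaginDual_apply
    (MonoidHom.mk' (fun χ : PontryaginDual X => y (r (e.symm (Additive.ofMul χ)))) fun χ ψ => by
      rw [← hy]
      apply hfac
      rw [map_add, hr, hr, hr, ofMul_mul, map_add])
  refine ⟨x, fun p => ?_⟩
  have h1 := hx (e (π p)).toMul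
  change dualPairing (π p) x = y (r (e.symm (e (π p)))) at h1
  rw [h1]
  apply hfac
  rw [hr, LinearEquiv.symm_apply_apply]

/-- Expansiveness passes from `X`, seen as the homomorphisms on `P` trivial on the kernel of `π`,
to the homomorphisms trivial on a large finitely generated part of that kernel. -/
theorem exists_fg_forall_eq_one_of_expansive (hπ : Function.Surjective π) {T : Finset P}
    (hT : Submodule.span (MonoidAlgebra ℤ Γ) (T : Set P) = ⊤) {c : ℝ} (hc0 : 0 < c)
    (hc1 : c ≤ 1 / 2)
    (hc : ∀ x : X, (∀ g : Γ, ∀ t ∈ T, dist (dualPairing (π t) (g • x)) 1 ≤ c) → x = 1) :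
    ∃ J ≤ LinearMap.ker π, J.FG ∧ ∀ y ∈ circleHoms P, (∀ a ∈ J, y a = 1) →
      (∀ g : Γ, ∀ t ∈ T, dist (y (MonoidAlgebra.single g (1 : ℤ) • t)) 1 ≤ c) → ∀ p, y p = 1 := by
  have hC : IsClosed {y : P → Circle |
      ∀ g : Γ, ∀ t ∈ T, dist (y (MonoidAlgebra.single g (1 : ℤ) • t)) 1 ≤ c} := by
    simp only [Set.ofPred_forall]
    exact isClosed_iInter fun g => isClosed_iInter fun t => isClosed_iInter fun _ =>
      isClosed_le (by fun_prop) continuous_const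
  have hU : IsOpen {y : P → Circle | ∀ t ∈ T, dist (y t) 1 < c / 2} := by
    simp only [Set.ofPred_forall]
    exact isOpen_biInter_finset fun t _ => isOpen_lt (by fun_prop) continuous_const
  obtain ⟨J, hJ, hfg, h⟩ := exists_fg_forall_circleHoms (LinearMap.ker π) hC hU (by
    intro y hy hker hyC t ht
    obtain ⟨x, hx⟩ := exists_eq_dualPairing hπ hy hker
    have hx1 : x = 1 := hc x fun g t ht => by
      rw [dualPairing_smul, ← map_smul, ← hx]
      exact hyC g⁻¹ t ht
    rw [hx, hx1, dualPairing_one, dist_self]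
    positivity)
  refine ⟨J, hJ, hfg, ?_⟩
  -- By compactness the bound `c` on an orbit improves to `c / 2`, so it also holds for the square.
  have hsq : ∀ y ∈ circleHoms P, (∀ a ∈ J, y a = 1) →
      (∀ g : Γ, ∀ t ∈ T, dist (y (MonoidAlgebra.single g (1 : ℤ) • t)) 1 ≤ c) →
      ∀ g : Γ, ∀ t ∈ T, dist (y (MonoidAlgebra.single g (1 : ℤ) • t) ^ 2) 1 ≤ c := by
    intro y hy hyJ hyC g t ht
    have h1 := h _ (circleHoms_smul hy (MonoidAlgebra.single g (1 : ℤ)))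
      (fun a ha => hyJ _ (J.smul_mem _ ha)) (fun k t ht => by
        beta_reduce
        rw [smul_smul, MonoidAlgebra.single_mul_single, one_mul]
        exact hyC (g * k) t ht) t ht
    linarith [Circle.dist_sq_one_le (y (MonoidAlgebra.single g (1 : ℤ) • t))]
  have hpow : ∀ n : ℕ, ∀ y ∈ circleHoms P, (∀ a ∈ J, y a = 1) →
      (∀ g : Γ, ∀ t ∈ T, dist (y (MonoidAlgebra.single g (1 : ℤ) • t)) 1 ≤ c) →
      ∀ g : Γ, ∀ t ∈ T, dist (y (MonoidAlgebra.single g (1 : ℤ) • t) ^ 2 ^ n) 1 ≤ c := by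
    intro n
    induction n with
    | zero =>
      intro y _ _ hyC
      simpa using hyC
    | succ n ih =>
      intro y hy hyJ hyC g t ht
      have h1 := ih _ (circleHoms_sq hy) (fun a ha => by simp only [hyJ a ha, one_pow])
        (hsq y hy hyJ hyC) g t ht
      rwa [← pow_mul, ← pow_succ'] at h1
  intro y hy hyJ hyC
  exact circleHoms_eq_one_of_span hT hy fun g t ht =>
    Circle.eq_one_of_forall_dist_pow_le fun n => (hpow n y hy hyJ hyC g t ht).trans hc1

/-- On a finite set of elements of `P`, the homomorphisms trivial on a large finitely generated
part of the kernel of `π` are approximated by points of `X`. -/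
theorem exists_fg_forall_exists_dist_lt (hπ : Function.Surjective π) (W : Finset P) {r : ℝ}
    (hr : 0 < r) :
    ∃ J ≤ LinearMap.ker π, J.FG ∧ ∀ y ∈ circleHoms P, (∀ a ∈ J, y a = 1) →
      ∃ x : X, ∀ p ∈ W, dist (dualPairing (π p) x) (y p) < r := by
  have hU : IsOpen {y : P → Circle | ∃ x : X, ∀ p ∈ W, dist (dualPairing (π p) x) (y p) < r} := by
    simp only [Set.ofPred_exists, Set.ofPred_forall]
    exact isOpen_iUnion fun x => isOpen_biInter_finset fun t _ =>
      isOpen_lt (by fun_prop) continuous_const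
  obtain ⟨J, hJ, hfg, h⟩ := exists_fg_forall_circleHoms (LinearMap.ker π) isClosed_univ hU (by
    intro y hy hker _
    obtain ⟨x, hx⟩ := exists_eq_dualPairing hπ hy hker
    exact ⟨x, fun p _ => by rw [hx, dist_self]; exact hr⟩)
  exact ⟨J, hJ, hfg, fun y hy hyJ => h y hy hyJ trivial⟩

end Pairing

/-! ### Metric estimates and pseudo-orbit tracing -/

section Metric

variable {Γ X : Type*} [Group Γ] [MetricSpace X] [CompactSpace X] [CommGroup X]
  [IsTopologicalGroup X] [MulDistribMulAction Γ X] [ContinuousConstSMul Γ X]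

/-- Finitely many characters control the metric of a compact abelian group. -/
theorem exists_finset_pontryaginDual_dist_lt {X : Type*} [MetricSpace X] [CompactSpace X]
    [CommGroup X] [IsTopologicalGroup X] {δ : ℝ} (hδ : 0 < δ) :
    ∃ (E : Finset (PontryaginDual X)) (c : ℝ), 0 < c ∧
      ∀ x y : X, (∀ χ ∈ E, dist (χ x) (χ y) ≤ c) → dist x y < δ := by
  classical
  have hK : IsCompact {p : X × X | δ ≤ dist p.1 p.2} :=
    (isClosed_le continuous_const (by fun_prop)).isCompact
  obtain ⟨u, hu⟩ := hK.elim_finite_subfamily_closed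
    (fun i : PontryaginDual X × ℕ => {p : X × X | dist (i.1 p.1) (i.1 p.2) ≤ 1 / ((i.2 : ℝ) + 1)})
    (fun i => isClosed_le (by fun_prop) continuous_const) (by
      rw [Set.eq_empty_iff_forall_notMem]
      rintro ⟨x, y⟩ ⟨hp, hi⟩
      have hxy : x / y ≠ 1 := by
        intro h
        rw [div_eq_one.1 h] at hp
        exact absurd hp (by simpa using hδ)
      obtain ⟨χ, hχ⟩ := exists_pontryaginDual_apply_ne_one hxy
      have hpos : 0 < dist (χ x) (χ y) := by
        rw [dist_pos]
        intro h
        rw [map_div, h, div_self'] at hχ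
        exact hχ rfl
      obtain ⟨n, hn⟩ := exists_nat_one_div_lt hpos
      exact absurd (Set.mem_iInter.1 hi (χ, n)) (not_le.2 hn))
  refine ⟨u.image Prod.fst, 1 / ((u.sup Prod.snd : ℕ) + 1), by positivity, fun x y h => ?_⟩
  by_contra! hd
  refine Set.eq_empty_iff_forall_notMem.1 hu (x, y) ⟨hd, Set.mem_iInter₂.2 fun i hi => ?_⟩
  refine (h i.1 (Finset.mem_image_of_mem _ hi)).trans ?_
  have : i.2 ≤ u.sup Prod.snd := Finset.le_sup (f := Prod.snd) hi
  have : (i.2 : ℝ) ≤ (u.sup Prod.snd : ℕ) := by exact_mod_cast this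
  gcongr

/-- Homomorphisms trivial on a large finitely generated part of the kernel of `π` are uniformly
close, along the `Γ`-orbits of `T`, to points of `X`. Indeed, points that approximate the translates
of such a homomorphism `y` on a suitable finite window form a pseudo-orbit, and a point that traces
it is close to `y`. -/
theorem exists_fg_forall_exists_dist_dualPairing_le {P : Type*} [AddCommGroup P]
    [Module (MonoidAlgebra ℤ Γ) P] {π : P →ₗ[MonoidAlgebra ℤ Γ] DualModule Γ X}
    (hpot : HasPseudoOrbitTracing Γ X) (hπ : Function.Surjective π) (T : Finset P) {c : ℝ}
    (hc : 0 < c) :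
    ∃ J ≤ LinearMap.ker π, J.FG ∧ ∀ y ∈ circleHoms P, (∀ a ∈ J, y a = 1) →
      ∃ x : X, ∀ g : Γ, ∀ t ∈ T,
        dist (y (MonoidAlgebra.single g (1 : ℤ) • t))
          (dualPairing (π (MonoidAlgebra.single g (1 : ℤ) • t)) x) ≤ c := by
  classical
  -- Points of `X` at distance less than `ε` have characters in `T` at distance less than `c / 2`.
  obtain ⟨ε, hε, hεT⟩ : ∃ ε > 0, ∀ t ∈ T, ∀ a b : X, dist a b < ε →
      dist (dualPairing (π t) a) (dualPairing (π t) b) < c / 2 := by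
    have huc : UniformContinuous fun (a : X) (t : T) => dualPairing (π t) a :=
      CompactSpace.uniformContinuous_of_continuous
        (continuous_pi fun t => continuous_dualPairing _)
    obtain ⟨ε, hε, h⟩ := Metric.uniformContinuous_iff.1 huc (c / 2) (by positivity)
    exact ⟨ε, hε, fun t ht a b hab => (dist_pi_lt_iff (by positivity)).1 (h hab) ⟨t, ht⟩⟩
  obtain ⟨δ, hδ, S, hS, htr⟩ := hpot ε hε
  obtain ⟨E, c', hc', hE⟩ := exists_finset_pontryaginDual_dist_lt (X := X) hδ
  choose lift hlift using fun χ : PontryaginDual X =>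
    hπ ((dualRepresentation Γ X).asModuleEquiv.symm (Additive.ofMul χ))
  have hval : ∀ χ x, dualPairing (π (lift χ)) x = χ x := fun χ x => by
    rw [hlift]
    rfl
  -- The window sees `T`, the characters `E` that control the metric, and their `S`-translates.
  let W : Finset P := T ∪ E.image lift ∪
    (hS.toFinset ×ˢ E).image fun q => MonoidAlgebra.single q.1⁻¹ (1 : ℤ) • lift q.2
  obtain ⟨J, hJ, hfg, h⟩ := exists_fg_forall_exists_dist_lt hπ W
    (r := min (c / 2) (c' / 2)) (by positivity)
  refine ⟨J, hJ, hfg, fun y hy hyJ => ?_⟩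
  have hg : ∀ g : Γ, ∃ x : X, ∀ p ∈ W, dist (dualPairing (π p) x)
      (y (MonoidAlgebra.single g⁻¹ (1 : ℤ) • p)) < min (c / 2) (c' / 2) := fun g =>
    h _ (circleHoms_smul hy _) fun a ha => hyJ _ (J.smul_mem _ ha)
  choose z hz using hg
  have horbit : IsPseudoOrbit S δ z := by
    intro s hs g
    refine hE _ _ fun χ hχ => ?_
    have h1 := hz g (MonoidAlgebra.single s⁻¹ (1 : ℤ) • lift χ) (Finset.mem_union_right _
      (Finset.mem_image.2 ⟨(s, χ), by simpa using ⟨hs, hχ⟩, rfl⟩))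
    have h2 := hz (s * g) (lift χ) (Finset.mem_union_left _ (Finset.mem_union_right _
      (Finset.mem_image_of_mem _ hχ)))
    rw [map_smul, ← dualPairing_smul, hval, smul_smul, MonoidAlgebra.single_mul_single, one_mul,
      ← mul_inv_rev] at h1
    rw [hval] at h2
    have h3 := dist_triangle_right (χ (s • z g)) (χ (z (s * g)))
      (y (MonoidAlgebra.single (s * g)⁻¹ (1 : ℤ) • lift χ))
    linarith [min_le_right (c / 2) (c' / 2)]
  obtain ⟨x, hx⟩ := htr z horbit
  refine ⟨x, fun g t ht => ?_⟩
  have h1 := hz g⁻¹ t (Finset.mem_union_left _ (Finset.mem_union_left _ ht))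
  have h2 := hεT t ht _ _ (hx g⁻¹)
  rw [inv_inv] at h1
  rw [dualPairing_smul, inv_inv, ← map_smul] at h2
  have h3 := dist_triangle_left (y (MonoidAlgebra.single g (1 : ℤ) • t))
    (dualPairing (π (MonoidAlgebra.single g (1 : ℤ) • t)) x) (dualPairing (π t) (z g⁻¹))
  rw [dist_comm (dualPairing (π t) (z g⁻¹)) (dualPairing _ x)] at h3
  linarith [min_le_left (c / 2) (c' / 2)]

/-- The relations between generators of the dual that witness expansiveness are finitely
generated: a homomorphism that is trivial on enough of them is uniformly close to a point of `X`
by pseudo-orbit tracing, and equals it by expansiveness. -/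
theorem ker_fg_of_hasPseudoOrbitTracing {P : Type*} [AddCommGroup P]
    [Module (MonoidAlgebra ℤ Γ) P] {π : P →ₗ[MonoidAlgebra ℤ Γ] DualModule Γ X}
    (hpot : HasPseudoOrbitTracing Γ X) (hπ : Function.Surjective π) {T : Finset P}
    (hT : Submodule.span (MonoidAlgebra ℤ Γ) (T : Set P) = ⊤) {c : ℝ} (hc0 : 0 < c)
    (hc1 : c ≤ 1 / 2)
    (hc : ∀ x : X, (∀ g : Γ, ∀ t ∈ T, dist (dualPairing (π t) (g • x)) 1 ≤ c) → x = 1) :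
    (LinearMap.ker π).FG := by
  obtain ⟨J₁, hJ₁, hfg₁, h₁⟩ := exists_fg_forall_eq_one_of_expansive hπ hT hc0 hc1 hc
  obtain ⟨J₂, hJ₂, hfg₂, h₂⟩ := exists_fg_forall_exists_dist_dualPairing_le hpot hπ T hc0
  have hle : LinearMap.ker π ≤ J₁ ⊔ J₂ := by
    intro a ha
    by_contra hna
    obtain ⟨y, hy, hyJ, hya⟩ := exists_circleHoms_apply_ne_one hna
    obtain ⟨x, hx⟩ := h₂ y hy fun b hb => hyJ b (le_sup_right (a := J₁) hb)
    have h3 := h₁ _ (circleHoms_div hy (dualPairing_mem_circleHoms π x))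
      (fun b hb => by
        have hb0 : π b = 0 := hJ₁ hb
        rw [hyJ b (le_sup_left (b := J₂) hb), hb0, one_div]
        exact inv_one)
      (fun g t ht => by
        rw [Circle.dist_div_one]
        exact hx g t ht) a
    have ha0 : π a = 0 := ha
    rw [ha0] at h3
    exact hya (div_eq_one.1 h3)
  rw [le_antisymm hle (sup_le hJ₁ hJ₂)]
  exact hfg₁.sup hfg₂

/-- A submodule of the dual that separates the points of `X` is the whole dual. -/
theorem submodule_dualModule_eq_top_of_separates
    {N : Submodule (MonoidAlgebra ℤ Γ) (DualModule Γ X)}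
    (hN : ∀ x : X, (∀ m ∈ N, dualPairing m x = 1) → x = 1) : N = ⊤ := by
  let e := (dualRepresentation Γ X).asModuleEquiv
  let N' : Subgroup (PontryaginDual X) :=
    { carrier := {χ | e.symm (Additive.ofMul χ) ∈ N}
      one_mem' := by
        rw [Set.mem_ofPred_eq, ofMul_one, map_zero]
        exact N.zero_mem
      mul_mem' := fun {χ ψ} hχ hψ => by
        rw [Set.mem_ofPred_eq, ofMul_mul, map_add]
        exact N.add_mem hχ hψ
      inv_mem' := fun {χ} hχ => by
        rw [Set.mem_ofPred_eq, ofMul_inv, map_neg]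
        exact N.neg_mem hχ }
  have h : N' = ⊤ := subgroup_pontryaginDual_eq_top_of_separates fun x hx =>
    hN x fun m hm => hx (e m).toMul hm
  refine eq_top_iff.2 fun m _ => ?_
  have hm : (e m).toMul ∈ N' := h ▸ trivial
  exact hm

end Metric

/-! ### Finite presentation of the dual -/

theorem mainTheorem5 (Γ X : Type*) [Group Γ] [Countable Γ]
    [MetricSpace X] [CompactSpace X] [CommGroup X] [IsTopologicalGroup X]
    [MulDistribMulAction Γ X] [ContinuousConstSMul Γ X]
    (hexp : IsExpansiveAction Γ X) (hpot : HasPseudoOrbitTracing Γ X) :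
    Module.FinitePresentation (MonoidAlgebra ℤ Γ) (DualModule Γ X) := by
  classical
  obtain ⟨η, hη, hexp⟩ := hexp
  obtain ⟨E, c, hc, hE⟩ := exists_finset_pontryaginDual_dist_lt (X := X) hη
  let s : Finset (DualModule Γ X) := E.image fun χ =>
    (dualRepresentation Γ X).asModuleEquiv.symm (Additive.ofMul χ)
  -- Expansiveness, in terms of finitely many characters.
  have hs : ∀ x : X, (∀ g : Γ, ∀ m ∈ s, dist (dualPairing m (g • x)) 1 ≤ c) → x = 1 := by
    intro x hx
    refine hexp x 1 fun g => hE _ _ fun χ hχ => ?_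
    rw [smul_one, map_one]
    exact hx g _ (Finset.mem_image_of_mem _ hχ)
  have hspan : Submodule.span (MonoidAlgebra ℤ Γ) (s : Set (DualModule Γ X)) = ⊤ := by
    refine submodule_dualModule_eq_top_of_separates fun x hx => hs x fun g m hm => ?_
    rw [dualPairing_smul, hx _ (Submodule.smul_mem _ _ (Submodule.subset_span hm)), dist_self]
    exact hc.le
  have hπ : Function.Surjective
      (Finsupp.linearCombination (MonoidAlgebra ℤ Γ) ((↑) : s → DualModule Γ X)) := by
    rw [← LinearMap.range_eq_top, Finsupp.range_linearCombination]
    simpa using hspan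
  refine ⟨s, hspan, ker_fg_of_hasPseudoOrbitTracing hpot hπ
    (T := Finset.univ.image fun m : s => Finsupp.single m 1) ?_ (c := min c (1 / 2))
    (by positivity) (min_le_right _ _) fun x hx => hs x fun g m hm => ?_⟩
  · rw [Finset.coe_image, Finset.coe_univ, Set.image_univ]
    exact (Finsupp.basisSingleOne (R := MonoidAlgebra ℤ Γ) (ι := s)).span_eq
  · have h := hx g (Finsupp.single ⟨m, hm⟩ 1) (Finset.mem_image_of_mem _ (Finset.mem_univ _))
    rw [Finsupp.linearCombination_single, one_smul] at h
    exact h.trans (min_le_left _ _)
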